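/- Let $k$ be a field and let $M$ be a finite monoid which is an inverse semigroup, i.e. for every $a\in M$ there is a unique $b\in M$ with $aba=a$ and $bab=b$. Write $x\,\mathcal L\,y$ if $Mx=My$, $x\,\mathcal R\,y$ if $xM=yM$, $x\,\mathcal H\,y$ if both hold, and $x\,\mathcal D\,y$ if $x\,\mathcal L\,z$ and $z\,\mathcal R\,y$ for some $z\in M$; let $H_x$ denote the $\mathcal H$-class of $x$. In every $\mathcal D$-class $D$ choose a base element $\gamma_D\in D$, put $H=H_{\gamma_D}$, and let $G_D$ be the Schützenberger group of $D$, that is, the group of all maps $r_m:H\to H$, $h\mapsto hm$, where $m\in M$ satisfies $Hm\subseteq H$, with product $r_mr_n=r_{mn}$. A $k$-algebra $A$ is called a cell algebra if there are a finite partially ordered set $\Lambda$, finite sets $L(\lambda),R(\lambda)$ for $\lambda\in\Lambda$, and a $k$-basis $\{{}_sC^\lambda_t : \lambda\in\Lambda,\ s\in L(\lambda),\ t\in R(\lambda)\}$ of $A$ (indexed without repetition) such that, with $\hat A^\lambda$ the span of all ${}_sC^\mu_t$ with $\mu>\lambda$, for all $a\in A$ and $\lambda\in\Lambda$: (i) there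 are scalars $r_L(a,\lambda,s,s')\in k$ ($s,s'\in L(\lambda)$) such that for all $s\in L(\lambda)$, $t\in R(\lambda)$, $a\cdot{}_sC^\lambda_t\equiv\sum_{s'\in L(\lambda)}r_L(a,\lambda,s,s')\,{}_{s'}C^\lambda_t \pmod{\hat A^\lambda}$; (ii) there are scalars $r_R(a,\lambda,t,t')\in k$ ($t,t'\in R(\lambda)$) such that for all $s\in L(\lambda)$, $t\in R(\lambda)$, ${}_sC^\lambda_t\cdot a\equiv\sum_{t'\in R(\lambda)}r_R(a,\lambda,t,t')\,{}_sC^\lambda_{t'} \pmod{\hat A^\lambda}$. Assume that $M$ satisfies the $k$-C.A. condition: the group algebra $k[G_D]$ is a cell algebra for every $\mathcal D$-class $D$ of $M$. Let $\pi:M\times M\to k$ be a twisting, i.e. $\pi(x,y)\pi(xy,z)=\pi(x,yz)\pi(y,z)$ and $\pi(x,1)=1=\pi(1,x)$ for all $x,y,z\in M$, and assume that $\pi$ is strongly compatible, i.e. for all $a,x\in M$: (1) if $ax\,\mathcal D\,x$, then $\pi(a,y)=\pi(a,x)\neq0$ for all $y\in H_x$; (2) if $xa\,\mathcal D\,x$,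 then $\pi(y,a)=\pi(x,a)\neq0$ for all $y\in H_x$. Let $k^\pi[M]$ be the twisted monoid algebra, i.e. the $k$-vector space with basis $M$ and the bilinear multiplication determined by $x\circ y=\pi(x,y)\,xy$ for $x,y\in M$. Then $k^\pi[M]$ is semisimple if and only if $k[G_D]$ is semisimple for every $\mathcal D$-class $D$ of $M$. -/

import Mathlib

/-! ## Green's relations, inverse monoids -/

section Green

/-- Green's relation `L`: the left ideals `Mx` and `My` coincide. -/
def GreenL {M : Type*} [Monoid M] (x y : M) : Prop :=
  Set.range (fun m : M => m * x) = Set.range (fun m : M => m * y)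

/-- Green's relation `R`: the right ideals `xM` and `yM` coincide. -/
def GreenR {M : Type*} [Monoid M] (x y : M) : Prop :=
  Set.range (fun m : M => x * m) = Set.range (fun m : M => y * m)

/-- Green's relation `H`, the intersection of `L` and `R`. -/
def GreenH {M : Type*} [Monoid M] (x y : M) : Prop :=
  GreenL x y ∧ GreenR x y

/-- Green's relation `D`, the composition of `L` and `R`. -/
def GreenD {M : Type*} [Monoid M] (x y : M) : Prop :=
  ∃ z : M, GreenL x z ∧ GreenR z y

theorem greenL_iff {M : Type*} [Monoid M] {x y : M} :
    GreenL x y ↔ (∃ a, x = a * y) ∧ (∃ b, y = b * x) := by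
  constructor
  · intro h
    have hx : x ∈ Set.range (fun m : M => m * x) := ⟨1, one_mul x⟩
    have hy : y ∈ Set.range (fun m : M => m * y) := ⟨1, one_mul y⟩
    rw [h] at hx
    rw [← h] at hy
    obtain ⟨a, ha⟩ := hx
    obtain ⟨b, hb⟩ := hy
    exact ⟨⟨a, ha.symm⟩, ⟨b, hb.symm⟩⟩
  · rintro ⟨⟨a, ha⟩, ⟨b, hb⟩⟩
    apply Set.Subset.antisymm
    · rintro _ ⟨m, rfl⟩
      exact ⟨m * a, by simp only [mul_assoc, ← ha]⟩
    · rintro _ ⟨m, rfl⟩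
      exact ⟨m * b, by simp only [mul_assoc, ← hb]⟩

theorem greenR_iff {M : Type*} [Monoid M] {x y : M} :
    GreenR x y ↔ (∃ a, x = y * a) ∧ (∃ b, y = x * b) := by
  constructor
  · intro h
    have hx : x ∈ Set.range (fun m : M => x * m) := ⟨1, mul_one x⟩
    have hy : y ∈ Set.range (fun m : M => y * m) := ⟨1, mul_one y⟩
    rw [h] at hx
    rw [← h] at hy
    obtain ⟨a, ha⟩ := hx
    obtain ⟨b, hb⟩ := hy
    exact ⟨⟨a, ha.symm⟩, ⟨b, hb.symm⟩⟩
  · rintro ⟨⟨a, ha⟩, ⟨b, hb⟩⟩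
    apply Set.Subset.antisymm
    · rintro _ ⟨m, rfl⟩
      exact ⟨a * m, by simp only [← mul_assoc, ← ha]⟩
    · rintro _ ⟨m, rfl⟩
      exact ⟨b * m, by simp only [← mul_assoc, ← hb]⟩

/-- The relations `L` and `R` commute. -/
theorem greenD_comm {M : Type*} [Monoid M] {x y : M} :
    GreenD x y ↔ ∃ z : M, GreenR x z ∧ GreenL z y := by
  constructor
  · rintro ⟨z, hxz, hzy⟩
    obtain ⟨⟨b, hb⟩, ⟨a, ha⟩⟩ := greenL_iff.1 hxz
    obtain ⟨⟨d, hd⟩, ⟨c, hc⟩⟩ := greenR_iff.1 hzy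
    refine ⟨x * c, greenR_iff.2 ⟨⟨d, ?_⟩, ⟨c, rfl⟩⟩, greenL_iff.2 ⟨⟨b, ?_⟩, ⟨a, ?_⟩⟩⟩
    · calc x = b * z := hb
        _ = b * (z * c * d) := by rw [← hc, ← hd]
        _ = b * z * c * d := by simp only [mul_assoc]
        _ = x * c * d := by rw [← hb]
    · rw [hb, hc, mul_assoc]
    · rw [hc, ha, mul_assoc]
  · rintro ⟨z, hxz, hzy⟩
    obtain ⟨⟨d, hd⟩, ⟨c, hc⟩⟩ := greenR_iff.1 hxz
    obtain ⟨⟨b, hb⟩, ⟨a, ha⟩⟩ := greenL_iff.1 hzy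
    refine ⟨a * x, greenL_iff.2 ⟨⟨b, ?_⟩, ⟨a, rfl⟩⟩, greenR_iff.2 ⟨⟨d, ?_⟩, ⟨c, ?_⟩⟩⟩
    · calc x = z * d := hd
        _ = b * (a * z) * d := by rw [← ha, ← hb]
        _ = b * (a * (z * d)) := by simp only [mul_assoc]
        _ = b * (a * x) := by rw [← hd]
    · rw [hd, ha, mul_assoc]
    · rw [ha, hc, mul_assoc]

theorem GreenD.equivalence (M : Type*) [Monoid M] :
    Equivalence (GreenD : M → M → Prop) where
  refl x := ⟨x, rfl, rfl⟩
  symm := by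
    rintro x y ⟨z, hxz, hzy⟩
    exact greenD_comm.2 ⟨z, hzy.symm, hxz.symm⟩
  trans := by
    rintro x y w ⟨z, hxz, hzy⟩ hyw
    obtain ⟨u, hyu, huw⟩ := greenD_comm.1 hyw
    obtain ⟨v, hzv, hvw⟩ := greenD_comm.2 ⟨u, (hzy.trans hyu : GreenR z u), huw⟩
    exact ⟨v, hxz.trans hzv, hvw⟩

/-- The equivalence relation `D` on `M`. -/
def greenDSetoid (M : Type*) [Monoid M] : Setoid M :=
  ⟨GreenD, GreenD.equivalence M⟩

/-- The set of `D`-classes of `M`. -/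
def DClass (M : Type*) [Monoid M] : Type _ :=
  Quotient (greenDSetoid M)

/-- The `D`-class of an element. -/
def DClass.mk {M : Type*} [Monoid M] (x : M) : DClass M :=
  Quotient.mk (greenDSetoid M) x

/-- The monoid `M` is an inverse semigroup: every element has a unique inverse in the sense of
semigroup theory. -/
def IsInverseMonoid (M : Type*) [Monoid M] : Prop :=
  ∀ a : M, ∃! b : M, a * b * a = a ∧ b * a * b = b

end Green

/-! ## Schützenberger groups -/

section Schutzenberger

/-- The `H`-class of `x`. -/
def HClass {M : Type*} [Monoid M] (x : M) : Set M :=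
  {y | GreenH x y}

/-- `RT(H)`: the elements `m` with `H m ⊆ H`, where `H` is the `H`-class of `x`. -/
def rightTranslators {M : Type*} [Monoid M] (x : M) : Set M :=
  {m | ∀ h ∈ HClass x, h * m ∈ HClass x}

/-- If `m ∈ RT(H)`, there is `t` such that `h ↦ h t` inverts `h ↦ h m` on `H`. -/
theorem exists_inverse_translation {M : Type*} [Monoid M] {x m : M}
    (hm : m ∈ rightTranslators x) :
    ∃ t ∈ rightTranslators x, ∀ h ∈ HClass x, h * m * t = h ∧ h * t * m = h := by
  have hx : x ∈ HClass x := ⟨rfl, rfl⟩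
  have hxm : GreenH x (x * m) := hm x hx
  obtain ⟨⟨t, ht⟩, -⟩ := greenR_iff.1 hxm.2
  obtain ⟨-, ⟨c, hc⟩⟩ := greenL_iff.1 hxm.1
  have h1 : ∀ h ∈ HClass x, h * m * t = h := by
    intro h hh
    obtain ⟨-, ⟨s, hs⟩⟩ := greenL_iff.1 hh.1
    rw [hs, mul_assoc s, mul_assoc s, ← ht]
  have h2 : ∀ h ∈ HClass x, h * t * m = h := by
    intro h hh
    obtain ⟨⟨s, hs⟩, -⟩ := greenL_iff.1 (hxm.1.symm.trans hh.1 : GreenL (x * m) h).symm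
    calc h * t * m = s * (x * m * t) * m := by rw [hs]; simp only [mul_assoc]
      _ = s * (x * m) := by rw [← ht, mul_assoc]
      _ = h := hs.symm
  refine ⟨t, ?_, fun h hh => ⟨h1 h hh, h2 h hh⟩⟩
  intro h hh
  refine ⟨?_, ?_⟩
  · -- `h t` is in the `L`-class of `x`
    obtain ⟨⟨p, hp⟩, ⟨q, hq⟩⟩ := greenL_iff.1 (hxm.1.symm.trans hh.1 : GreenL (x * m) h)
    refine greenL_iff.2 ⟨⟨p, ?_⟩, ⟨q, ?_⟩⟩
    · rw [← mul_assoc, ← hp, ← ht]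
    · rw [hq, mul_assoc q, ← ht]
  · exact (hh.2.trans (greenR_iff.2 ⟨⟨m, (h2 h hh).symm⟩, ⟨t, rfl⟩⟩ : GreenR h (h * t)) :)

/-- The (right) Schützenberger group `{r_m : m ∈ RT(H)}` of the `H`-class `H` of `x`, where
`r_m : H → H`, `h ↦ h m`.  Maps act on the right of their arguments (`r_m r_n = r_{mn}`), so the
product is that of the opposite of the group of permutations of `H`. -/
def SchutzenbergerGroup {M : Type*} [Monoid M] (x : M) :
    Subgroup (Equiv.Perm (HClass x))ᵐᵒᵖ where
  carrier := {g | ∃ m ∈ rightTranslators x, ∀ h : HClass x, (g.unop h : M) = h * m}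
  one_mem' := ⟨1, fun h hh => by rwa [mul_one], fun h => by simp⟩
  mul_mem' := by
    rintro f g ⟨m, hm, hf⟩ ⟨n, hn, hg⟩
    refine ⟨m * n, fun h hh => ?_, fun h => ?_⟩
    · rw [← mul_assoc]
      exact hn _ (hm _ hh)
    · rw [MulOpposite.unop_mul, Equiv.Perm.mul_apply, hg, hf, mul_assoc]
  inv_mem' := by
    rintro f ⟨m, hm, hf⟩
    obtain ⟨t, ht, hmt⟩ := exists_inverse_translation hm
    refine ⟨t, ht, fun h => ?_⟩
    obtain ⟨g, rfl⟩ := f.unop.surjective h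
    have hg : (f.unop)⁻¹ (f.unop g) = g := f.unop.symm_apply_apply g
    rw [MulOpposite.unop_inv, hg, hf, (hmt g g.2).1]

/-- Every right translation `r_m` with `m ∈ RT(H)` is an element of the Schützenberger group. -/
theorem exists_mem_schutzenbergerGroup {M : Type*} [Monoid M] {x m : M}
    (hm : m ∈ rightTranslators x) :
    ∃ g ∈ SchutzenbergerGroup x, ∀ h : HClass x, (g.unop h : M) = h * m := by
  obtain ⟨t, ht, hmt⟩ := exists_inverse_translation hm
  exact ⟨MulOpposite.op
    { toFun := fun h => ⟨h * m, hm h h.2⟩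
      invFun := fun h => ⟨h * t, ht h h.2⟩
      left_inv := fun h => Subtype.ext (hmt h h.2).1
      right_inv := fun h => Subtype.ext (hmt h h.2).2 }, ⟨m, hm, fun _ => rfl⟩, fun _ => rfl⟩

end Schutzenberger

/-! ## Cell algebras -/

section Cell

/-- The `R`-span of the basis elements `_s C_t^μ` with `μ > l`. -/
def cellSpanAbove {R A Λ : Type*} [CommRing R] [Ring A] [Algebra R A] [PartialOrder Λ]
    {Lt Rt : Λ → Type*} (C : Module.Basis (Σ l : Λ, Lt l × Rt l) R A) (l : Λ) : Submodule R A :=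
  Submodule.span R {a | ∃ μ : Λ, l < μ ∧ ∃ (s : Lt μ) (t : Rt μ), a = C ⟨μ, (s, t)⟩}

/-- The basis `_s C_t^l` (`l ∈ Λ`, `s` a left index, `t` a right index for `l`) is a cell basis:
modulo the span of the basis elements with larger upper index, left multiplication acts on the left
index with coefficients independent of the right index, and vice versa. -/
def IsCellBasis {R A Λ : Type*} [CommRing R] [Ring A] [Algebra R A] [PartialOrder Λ]
    {Lt Rt : Λ → Type*} [∀ l, Fintype (Lt l)] [∀ l, Fintype (Rt l)]
    (C : Module.Basis (Σ l : Λ, Lt l × Rt l) R A) : Prop :=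
  (∀ (a : A) (l : Λ) (s : Lt l), ∃ r : Lt l → R, ∀ t : Rt l,
    a * C ⟨l, (s, t)⟩ - ∑ s' : Lt l, r s' • C ⟨l, (s', t)⟩ ∈ cellSpanAbove C l) ∧
  (∀ (a : A) (l : Λ) (t : Rt l), ∃ r : Rt l → R, ∀ s : Lt l,
    C ⟨l, (s, t)⟩ * a - ∑ t' : Rt l, r t' • C ⟨l, (s, t')⟩ ∈ cellSpanAbove C l)

/-- The `R`-algebra `A` has a cell algebra structure: it has a cell basis with respect to some
finite poset `Λ` and some finite sets of left and right indices.  (Finite index sets may be taken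
in the lowest universe.) -/
def IsCellAlgebra (R A : Type*) [CommRing R] [Ring A] [Algebra R A] : Prop :=
  ∃ (Λ : Type) (_ : PartialOrder Λ) (_ : Finite Λ) (Lt Rt : Λ → Type)
    (_ : ∀ l, Fintype (Lt l)) (_ : ∀ l, Fintype (Rt l))
    (C : Module.Basis (Σ l : Λ, Lt l × Rt l) R A), IsCellBasis C

/-- The `R`-C.A. condition on `M`, with respect to a choice `γ` of a base element in every
`D`-class: the group algebra over `R` of every Schützenberger group `G_D` is a cell algebra. -/
def SatisfiesCA (R : Type*) [CommRing R] {M : Type*} [Monoid M] (γ : DClass M → M) : Prop :=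
  ∀ D : DClass M, IsCellAlgebra R (MonoidAlgebra R (SchutzenbergerGroup (γ D)))

end Cell

/-! ## Twisted monoid algebras -/

section Twisted

/-- A twisting on the monoid `M` with values in `R`. -/
structure Twisting (M R : Type*) [Monoid M] [CommRing R] where
  toFun : M → M → R
  cocycle : ∀ x y z : M, toFun x y * toFun (x * y) z = toFun x (y * z) * toFun y z
  map_one_right : ∀ x : M, toFun x 1 = 1
  map_one_left : ∀ x : M, toFun 1 x = 1

instance Twisting.instCoeFun {M R : Type*} [Monoid M] [CommRing R] :
    CoeFun (Twisting M R) (fun _ => M → M → R) :=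
  ⟨Twisting.toFun⟩

/-- Strongly compatible twistings. -/
def Twisting.StronglyCompatible {M R : Type*} [Monoid M] [CommRing R] (π : Twisting M R) : Prop :=
  (∀ a x : M, GreenD (a * x) x → ∀ y ∈ HClass x, π a y = π a x ∧ π a x ≠ 0) ∧
  (∀ a x : M, GreenD (x * a) x → ∀ y ∈ HClass x, π y a = π x a ∧ π x a ≠ 0)

/-- The twisted monoid algebra: the free `R`-module on `M` with the product of basis elements
`x ∘ y = π(x, y) xy`. -/
def TwistedMonoidAlgebra {M R : Type*} [Monoid M] [CommRing R] (_π : Twisting M R) : Type _ :=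
  M →₀ R

namespace TwistedMonoidAlgebra

variable {M R : Type*} [Monoid M] [CommRing R] (π : Twisting M R)

noncomputable instance instAddCommGroup : AddCommGroup (TwistedMonoidAlgebra π) :=
  inferInstanceAs (AddCommGroup (M →₀ R))

noncomputable instance instModule : Module R (TwistedMonoidAlgebra π) :=
  inferInstanceAs (Module R (M →₀ R))

/-- The basis of the twisted monoid algebra formed by the elements of `M`. -/
noncomputable def basis : Module.Basis M R (TwistedMonoidAlgebra π) :=
  Module.Basis.ofRepr (LinearEquiv.refl R (M →₀ R))

/-- The bilinear product determined by `x ∘ y = π(x, y) xy`. -/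
noncomputable def mulLin :
    TwistedMonoidAlgebra π →ₗ[R] TwistedMonoidAlgebra π →ₗ[R] TwistedMonoidAlgebra π :=
  (basis π).constr R fun x => (basis π).constr R fun y => π x y • basis π (x * y)

theorem mulLin_basis (x y : M) :
    mulLin π (basis π x) (basis π y) = π x y • basis π (x * y) := by
  simp [mulLin, Module.Basis.constr_basis]

theorem mulLin_assoc (a b c : TwistedMonoidAlgebra π) :
    mulLin π (mulLin π a b) c = mulLin π a (mulLin π b c) := by
  have h : (mulLin π).compr₂ (mulLin π) =
      (LinearMap.llcomp R _ _ _).flip (mulLin π) ∘ₗ (LinearMap.llcomp R _ _ _) ∘ₗ mulLin π := by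
    refine (basis π).ext fun x => (basis π).ext fun y => (basis π).ext fun z => ?_
    simp [mulLin_basis, smul_smul, π.cocycle x y z, mul_assoc, mul_comm]
  exact LinearMap.congr_fun (LinearMap.congr_fun (LinearMap.congr_fun h a) b) c

theorem one_mulLin (a : TwistedMonoidAlgebra π) : mulLin π (basis π 1) a = a := by
  have h : mulLin π (basis π 1) = LinearMap.id :=
    (basis π).ext fun x => by simp [mulLin_basis, π.map_one_left]
  rw [h, LinearMap.id_apply]

theorem mulLin_one (a : TwistedMonoidAlgebra π) : mulLin π a (basis π 1) = a := by
  have h : (mulLin π).flip (basis π 1) = LinearMap.id :=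
    (basis π).ext fun x => by simp [mulLin_basis, π.map_one_right]
  rw [← LinearMap.flip_apply, h, LinearMap.id_apply]

noncomputable instance instRing : Ring (TwistedMonoidAlgebra π) where
  __ := instAddCommGroup π
  mul a b := mulLin π a b
  one := basis π 1
  mul_assoc := mulLin_assoc π
  one_mul := one_mulLin π
  mul_one := mulLin_one π
  zero_mul a := by
    change mulLin π 0 a = 0
    rw [map_zero, LinearMap.zero_apply]
  mul_zero a := map_zero (mulLin π a)
  left_distrib a b c := map_add (mulLin π a) b c
  right_distrib a b c := by
    change mulLin π (a + b) c = mulLin π a c + mulLin π b c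
    rw [map_add, LinearMap.add_apply]

noncomputable instance instAlgebra : Algebra R (TwistedMonoidAlgebra π) :=
  Algebra.ofModule
    (fun r a b => by
      change mulLin π (r • a) b = r • mulLin π a b
      rw [map_smul, LinearMap.smul_apply])
    (fun r a b => map_smul (mulLin π a) r b)

theorem basis_mul_basis (x y : M) :
    basis π x * basis π y = π x y • basis π (x * y) :=
  mulLin_basis π x y

end TwistedMonoidAlgebra

end Twisted

/-! ## Von Neumann regular rings -/

/-! Both sides are compared through von Neumann regularity, which for Artinian rings is equivalent
to semisimplicity. Write `A` for the twisted algebra, let `g = γ D` with inverse `g'`, and put `e =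
g' * g`, an idempotent `L`-equivalent to `g`. The span of `eMe` is a corner of `A` with identity `e
/ π(e, e)`. Strong compatibility makes `π` constant on `H_e × H_e`, and the elements of `eMe`
outside `H_e` span an ideal, so `x ↦ π(e, e) r_x` on `H_e` and `0` elsewhere maps the corner
multiplicatively onto `k[G_D]` (`toGroupAlgebra_mul`, `exists_toGroupAlgebra_eq`).

If `A` is regular, so are its corners and their quotients `k[G_D]`.

Conversely, let `x ≠ 0` lie in the radical of `A`, and let `m` in its support have maximal ideal
`MmM`. Choose `a`, `b` with `amb = e`, the idempotent of the `D`-class of `m`. Two-sided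
cancellation (`IsInverseMonoid.eq_of_mul_mul_eq`) shows that no other support element is carried to
`e`, so the image of `a ∘ x ∘ b` in `k[G_D]` has nonzero coefficient at `1`. That image generates a
nil left ideal, so it vanishes if `k[G_D]` is regular: a contradiction. -/

/-- A ring is von Neumann regular if every element has a generalized inverse. -/
def IsVonNeumannRegular (A : Type*) [Ring A] : Prop :=
  ∀ x : A, ∃ y : A, x * y * x = x

/-- The left ideal generated by `x` has an idempotent generator `e = y * x`, which fixes `x` on the
right; hence `x * y * x = x * e = x`. -/
theorem IsSemisimpleRing.isVonNeumannRegular (A : Type*) [Ring A] [IsSemisimpleRing A] :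
    IsVonNeumannRegular A := by
  intro x
  obtain ⟨e, he, hx⟩ := IsSemisimpleRing.ideal_eq_span_idempotent (Ideal.span {x})
  obtain ⟨y, hy⟩ := Ideal.mem_span_singleton'.1 (hx ▸ Ideal.mem_span_singleton_self e)
  obtain ⟨z, hz⟩ := Ideal.mem_span_singleton'.1 (hx ▸ Ideal.mem_span_singleton_self x)
  refine ⟨y, ?_⟩
  rw [mul_assoc, hy, ← hz, mul_assoc, he]

/-- In a von Neumann regular ring, nonzero elements do not generate nil left ideals. -/
theorem IsVonNeumannRegular.eq_zero {A : Type*} [Ring A] (hA : IsVonNeumannRegular A) {z : A}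
    (hz : ∀ w : A, IsNilpotent (w * z)) : z = 0 := by
  obtain ⟨w, hw⟩ := hA z
  have hi : IsIdempotentElem (w * z) := by
    change w * z * (w * z) = w * z
    rw [mul_assoc, ← mul_assoc z, hw]
  obtain ⟨n, hn⟩ := hz w
  have h0 : w * z = 0 := by
    rw [← hi.pow_succ_eq n, pow_succ, hn, zero_mul]
  rw [← hw, mul_assoc, h0, mul_zero]

theorem isNilpotent_of_mem_jacobson {A : Type*} [Ring A] [IsArtinianRing A] {x : A}
    (hx : x ∈ Ring.jacobson A) : IsNilpotent x := by
  obtain ⟨n, hn⟩ := IsSemiprimaryRing.isNilpotent (R := A)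
  refine ⟨n, ?_⟩
  have h := Ideal.pow_mem_pow hx n
  rw [hn] at h
  exact h

theorem IsVonNeumannRegular.isSemisimpleRing {A : Type*} [Ring A] [IsArtinianRing A]
    (hA : IsVonNeumannRegular A) : IsSemisimpleRing A := by
  rw [IsArtinianRing.isSemisimpleRing_iff_jacobson, eq_bot_iff]
  intro z hz
  exact hA.eq_zero fun w => isNilpotent_of_mem_jacobson (Ideal.mul_mem_left _ w hz)

/-! ## Finite monoids and inverse monoids -/

section Monoid

variable {M : Type*} [Monoid M]

/-! ### Stability, commuting idempotents and cancellation. -/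

/-- Stability of finite monoids. -/
theorem exists_eq_of_eq_mul_mul [Finite M] {u y v : M} (h : y = u * y * v) :
    (∃ w, y = w * (u * y)) ∧ ∃ w, y = y * v * w := by
  have hn : ∀ n : ℕ, y = u ^ n * y * v ^ n := by
    intro n
    induction n with
    | zero => simp
    | succ n ih =>
      calc y = u ^ n * (u * y * v) * v ^ n := by rw [← h]; exact ih
        _ = u ^ (n + 1) * y * v ^ (n + 1) := by
          rw [pow_succ u, pow_succ' v]; simp only [mul_assoc]
  -- Powers repeat by pigeonhole. The period `d + 1` is positive, so one factor can be split off
  -- after inserting it into `y = u ^ i * y * v ^ i`.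
  have key : ∀ t : M, ∃ i d : ℕ, t ^ i = t ^ (i + (d + 1)) := by
    intro t
    obtain ⟨i, j, hij, h⟩ := Finite.exists_ne_map_eq_of_infinite (fun n : ℕ => t ^ n)
    rcases lt_or_gt_of_ne hij with hlt | hlt
    · obtain ⟨d, rfl⟩ := Nat.exists_eq_add_of_lt hlt
      exact ⟨i, d, h⟩
    · obtain ⟨d, rfl⟩ := Nat.exists_eq_add_of_lt hlt
      exact ⟨j, d, h.symm⟩
  constructor
  · obtain ⟨i, d, hd⟩ := key u
    refine ⟨u ^ d, ?_⟩
    calc y = u ^ i * y * v ^ i := hn i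
      _ = u ^ (d + 1) * (u ^ i * y * v ^ i) := by
        simp only [← mul_assoc]; rw [← pow_add, add_comm (d + 1), ← hd]
      _ = u ^ (d + 1) * y := by rw [← hn i]
      _ = u ^ d * (u * y) := by rw [pow_succ, mul_assoc]
  · obtain ⟨i, d, hd⟩ := key v
    refine ⟨v ^ d, ?_⟩
    calc y = u ^ i * y * v ^ i := hn i
      _ = u ^ i * y * v ^ i * v ^ (d + 1) := by
        rw [mul_assoc _ (v ^ i), ← pow_add, ← hd]
      _ = y * v ^ (d + 1) := by rw [← hn i]
      _ = y * v * v ^ d := by rw [pow_succ', mul_assoc]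

/-- If `x` is the inverse of `e * f`, then `f * x * e` is another one, so they agree and `x` is
idempotent. An idempotent is its own inverse, so `e * f = x`. -/
theorem IsInverseMonoid.isIdempotentElem_mul (hM : IsInverseMonoid M) {e f : M}
    (he : e * e = e) (hf : f * f = f) : e * f * (e * f) = e * f := by
  obtain ⟨x, ⟨h1, h2⟩, hu⟩ := hM (e * f)
  have hx : f * x * e = x := by
    refine hu _ ⟨?_, ?_⟩
    · calc e * f * (f * x * e) * (e * f) = e * (f * f) * x * ((e * e) * f) := by
            simp only [mul_assoc]
        _ = e * f := by rw [he, hf, h1]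
    · calc f * x * e * (e * f) * (f * x * e) = f * (x * ((e * e) * (f * f)) * x) * e := by
            simp only [mul_assoc]
        _ = f * x * e := by rw [he, hf, h2]
  have hxx : x * x = x := by
    calc x * x = f * x * e * (f * x * e) := by rw [hx]
      _ = f * (x * (e * f) * x) * e := by simp only [mul_assoc]
      _ = x := by rw [h2, hx]
  have hex : e * f = x :=
    (hM x).unique ⟨h2, h1⟩ ⟨by rw [hxx, hxx], by rw [hxx, hxx]⟩
  rw [hex, hxx]

/-- Both products are inverses of `e * f`. -/
theorem IsInverseMonoid.commute_of_idempotent (hM : IsInverseMonoid M) {e f : M}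
    (he : e * e = e) (hf : f * f = f) : e * f = f * e := by
  have h1 := hM.isIdempotentElem_mul he hf
  have h2 := hM.isIdempotentElem_mul hf he
  refine (hM (e * f)).unique ⟨by rw [h1, h1], by rw [h1, h1]⟩ ⟨?_, ?_⟩
  · calc e * f * (f * e) * (e * f) = e * (f * f) * ((e * e) * f) := by simp only [mul_assoc]
      _ = e * f := by rw [he, hf, h1]
  · calc f * e * (e * f) * (f * e) = f * (e * e) * ((f * f) * e) := by simp only [mul_assoc]
      _ = f * e := by rw [he, hf, h2]

/-- The idempotents `a' * a` and `y * y'` commute. Since `y * y' = w * a * (y * y')`, moving `a' *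
a` next to `a` absorbs it, so `y * y'` lies below `a' * a`. -/
theorem IsInverseMonoid.inv_mul_mul_cancel (hM : IsInverseMonoid M) {a a' y w : M}
    (ha : a * a' * a = a) (hw : y = w * (a * y)) : a' * a * y = y := by
  obtain ⟨y', ⟨hy, -⟩, -⟩ := hM y
  have hf : a' * a * (a' * a) = a' * a := by rw [mul_assoc, ← mul_assoc a, ha]
  have ht : y * y' * (y * y') = y * y' := by rw [← mul_assoc, hy]
  have hc := hM.commute_of_idempotent hf ht
  have h1 : y * y' * (a' * a) = y * y' := by
    have h2 : y * y' = w * a * (y * y') := by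
      rw [← mul_assoc, mul_assoc w, ← hw]
    calc y * y' * (a' * a) = w * a * (y * y') * (a' * a) := by rw [← h2]
      _ = w * a * (a' * a * (y * y')) := by rw [mul_assoc, hc]
      _ = w * (a * a' * a) * (y * y') := by simp only [mul_assoc]
      _ = y * y' := by rw [ha, ← h2]
  calc a' * a * y = a' * a * (y * y' * y) := by rw [hy]
    _ = a' * a * (y * y') * y := by simp only [mul_assoc]
    _ = y := by rw [hc, h1, hy]

theorem IsInverseMonoid.mul_mul_inv_cancel (hM : IsInverseMonoid M) {b b' y w : M}
    (hb : b * b' * b = b) (hw : y = y * b * w) : y * (b * b') = y := by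
  obtain ⟨y', ⟨hy, -⟩, -⟩ := hM y
  have hf : b * b' * (b * b') = b * b' := by rw [← mul_assoc, hb]
  have ht : y' * y * (y' * y) = y' * y := by rw [mul_assoc, ← mul_assoc y, hy]
  have hc := hM.commute_of_idempotent hf ht
  have h1 : b * b' * (y' * y) = y' * y := by
    have h2 : y' * y = y' * y * (b * w) := by
      rw [mul_assoc, ← mul_assoc y, ← hw]
    calc b * b' * (y' * y) = b * b' * (y' * y * (b * w)) := by rw [← h2]
      _ = y' * y * (b * b') * (b * w) := by rw [← mul_assoc, hc]
      _ = y' * y * (b * b' * b * w) := by simp only [mul_assoc]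
      _ = y' * y := by rw [hb, ← h2]
  calc y * (b * b') = y * y' * y * (b * b') := by rw [hy]
    _ = y * (y' * y * (b * b')) := by simp only [mul_assoc]
    _ = y := by rw [← hc, h1, ← mul_assoc, hy]

/-- Two-sided cancellation within a `J`-class of a finite inverse monoid. -/
theorem IsInverseMonoid.eq_of_mul_mul_eq [Finite M] (hM : IsInverseMonoid M) {a b y z : M}
    (hy : ∃ u v, y = u * (a * y * b) * v) (hz : ∃ u v, z = u * (a * z * b) * v)
    (h : a * y * b = a * z * b) : y = z := by
  obtain ⟨a', ⟨ha, -⟩, -⟩ := hM a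
  obtain ⟨b', ⟨hb, -⟩, -⟩ := hM b
  -- Stability turns the two-sided relation into one-sided ones, so `x` is recovered from `a * x *
  -- b` by multiplying with the inverses of `a` and `b`.
  have key : ∀ x : M, (∃ u v, x = u * (a * x * b) * v) → a' * (a * x * b) * b' = x := by
    rintro x ⟨u, v, hx⟩
    have hx' : x = u * a * x * (b * v) := hx.trans (by simp only [mul_assoc])
    obtain ⟨⟨w, hw⟩, w', hw'⟩ := exists_eq_of_eq_mul_mul hx'
    have h1 := hM.inv_mul_mul_cancel (w := w * u) ha (hw.trans (by simp only [mul_assoc]))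
    have h2 := hM.mul_mul_inv_cancel (w := v * w') hb (hw'.trans (by simp only [mul_assoc]))
    calc a' * (a * x * b) * b' = a' * a * x * (b * b') := by simp only [mul_assoc]
      _ = x := by rw [h1, h2]
  rw [← key y hy, ← key z hz, h]

/-! ### The maximal subgroup `H_e` as the group of units of `eMe`. -/

theorem mem_hClass_idempotent_iff {e x : M} (he : e * e = e) :
    x ∈ HClass e ↔ (e * x = x ∧ x * e = x) ∧ (∃ w, w * x = e) ∧ ∃ w, x * w = e := by
  change GreenL e x ∧ GreenR e x ↔ _
  rw [greenL_iff, greenR_iff]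
  constructor
  · rintro ⟨⟨⟨a, ha⟩, b, hb⟩, ⟨c, hc⟩, d, hd⟩
    exact ⟨⟨by rw [hd, ← mul_assoc, he], by rw [hb, mul_assoc, he]⟩, ⟨a, ha.symm⟩, c, hc.symm⟩
  · rintro ⟨⟨h1, h2⟩, ⟨a, ha⟩, c, hc⟩
    exact ⟨⟨⟨a, ha.symm⟩, x, h2.symm⟩, ⟨c, hc.symm⟩, x, h1.symm⟩

theorem mul_mem_hClass_idempotent {e x y : M} (he : e * e = e) (hx : x ∈ HClass e)
    (hy : y ∈ HClass e) : x * y ∈ HClass e := by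
  rw [mem_hClass_idempotent_iff he] at *
  obtain ⟨⟨hx1, hx2⟩, ⟨p, hp⟩, q, hq⟩ := hx
  obtain ⟨⟨hy1, hy2⟩, ⟨r, hr⟩, s, hs⟩ := hy
  refine ⟨⟨by rw [← mul_assoc, hx1], by rw [mul_assoc, hy2]⟩, ⟨r * p, ?_⟩, s * q, ?_⟩
  · rw [mul_assoc, ← mul_assoc p, hp, hy1, hr]
  · rw [mul_assoc, ← mul_assoc y, hs, ← mul_assoc, hx2, hq]

/-- By stability one-sided units of `eMe` are units, so the non-units of `eMe` form an ideal. This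
is why elements outside `H_e` can be sent to zero multiplicatively. -/
theorem mem_hClass_of_mul_mem [Finite M] {e x y : M} (he : e * e = e)
    (hx : e * x = x ∧ x * e = x) (hy : e * y = y ∧ y * e = y) (hxy : x * y ∈ HClass e) :
    x ∈ HClass e ∧ y ∈ HClass e := by
  simp only [mem_hClass_idempotent_iff he] at hxy ⊢
  obtain ⟨-, ⟨p, hp⟩, q, hq⟩ := hxy
  have h1 : e = x * e * (y * q) := by rw [hx.2, ← mul_assoc, hq]
  have h2 : e = p * x * e * y := by rw [mul_assoc, hy.1, mul_assoc, hp]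
  obtain ⟨⟨w, hw⟩, -⟩ := exists_eq_of_eq_mul_mul h1
  obtain ⟨-, w', hw'⟩ := exists_eq_of_eq_mul_mul h2
  rw [hx.2] at hw
  rw [hy.1] at hw'
  exact ⟨⟨hx, ⟨w, hw.symm⟩, y * q, by rw [← mul_assoc, hq]⟩,
    hy, ⟨p * x, by rw [mul_assoc, hp]⟩, w', hw'.symm⟩

/-! ### Identification of the Schützenberger group with `H_e`. -/

theorem GreenL.mul_right {x y : M} (h : GreenL x y) (m : M) : GreenL (x * m) (y * m) := by
  obtain ⟨⟨a, ha⟩, b, hb⟩ := greenL_iff.1 h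
  exact greenL_iff.2 ⟨⟨a, by rw [← mul_assoc, ← ha]⟩, b, by rw [← mul_assoc, ← hb]⟩

theorem GreenR.mul_left {x y : M} (h : GreenR x y) (m : M) : GreenR (m * x) (m * y) := by
  obtain ⟨⟨a, ha⟩, b, hb⟩ := greenR_iff.1 h
  exact greenR_iff.2 ⟨⟨a, by rw [mul_assoc, ← ha]⟩, b, by rw [mul_assoc, ← hb]⟩

/-- The `H`-class of an idempotent `e` acts by right translations on the `H`-classes in the
`L`-class of `e`. -/
theorem hClass_subset_rightTranslators {e g x : M} (he : e * e = e) (hg : GreenL e g)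
    (hx : x ∈ HClass e) : x ∈ rightTranslators g := by
  intro h hh
  have hLe : GreenL e h := hg.trans hh.1
  obtain ⟨-, s, hs⟩ := greenL_iff.1 hLe
  have hx' := hx
  rw [mem_hClass_idempotent_iff he] at hx'
  obtain ⟨⟨hx1, -⟩, -, w, hw⟩ := hx'
  refine ⟨?_, ?_⟩
  · have h1 : GreenL x (h * x) := by simpa [hx1] using hLe.mul_right x
    exact (hg.symm.trans hx.1 : GreenL g x).trans h1
  · refine (hh.2 : GreenR g h).trans (greenR_iff.2 ⟨⟨w, ?_⟩, x, rfl⟩)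
    rw [mul_assoc, hw, hs, mul_assoc, he]

/-- The element `r_x` of the Schützenberger group of `g`, or `1` if `x` is not a right
translator. -/
noncomputable def toSchutzenberger (g x : M) : SchutzenbergerGroup g :=
  open Classical in
  if h : x ∈ rightTranslators g then
    ⟨(exists_mem_schutzenbergerGroup h).choose, (exists_mem_schutzenbergerGroup h).choose_spec.1⟩
  else 1

theorem toSchutzenberger_apply {g x : M} (hx : x ∈ rightTranslators g) (h : HClass g) :
    ((toSchutzenberger g x).1.unop h : M) = h * x := by
  rw [toSchutzenberger, dif_pos hx]
  exact (exists_mem_schutzenbergerGroup hx).choose_spec.2 h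

theorem toSchutzenberger_mul {g x y : M} (hx : x ∈ rightTranslators g)
    (hy : y ∈ rightTranslators g) :
    toSchutzenberger g (x * y) = toSchutzenberger g x * toSchutzenberger g y := by
  have hxy : x * y ∈ rightTranslators g := fun h hh => by
    rw [← mul_assoc]; exact hy _ (hx _ hh)
  refine Subtype.ext (MulOpposite.unop_injective (Equiv.ext fun h => Subtype.ext ?_))
  rw [toSchutzenberger_apply hxy, Subgroup.coe_mul, MulOpposite.unop_mul, Equiv.Perm.mul_apply,
    toSchutzenberger_apply hy, toSchutzenberger_apply hx, mul_assoc]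

theorem self_mem_hClass (g : M) : g ∈ HClass g := ⟨rfl, rfl⟩

/-- Writing `e = s * g`, a translation fixing `g` fixes `e`, so `x = e * x = e`. -/
theorem toSchutzenberger_eq_one_iff {e g x : M} (he : e * e = e) (hg : GreenL e g)
    (hx : x ∈ HClass e) : toSchutzenberger g x = 1 ↔ x = e := by
  have hxT := hClass_subset_rightTranslators he hg hx
  obtain ⟨⟨s, hs⟩, t, ht⟩ := greenL_iff.1 hg
  constructor
  · intro h
    have h1 := toSchutzenberger_apply hxT ⟨g, self_mem_hClass g⟩
    rw [h] at h1
    change g = g * x at h1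
    rw [mem_hClass_idempotent_iff he] at hx
    rw [← hx.1.1, hs, mul_assoc, ← h1]
  · rintro rfl
    refine Subtype.ext (MulOpposite.unop_injective (Equiv.ext fun h => Subtype.ext ?_))
    rw [toSchutzenberger_apply hxT]
    obtain ⟨-, u, hu⟩ := greenL_iff.1 (hg.trans h.2.1 : GreenL x h)
    change (h : M) * x = h
    rw [hu, mul_assoc, he]

/-- Right multiplication by `e` is trivial on the `L`-class of `e`, so `m` and `e * m` induce the
same translation, and `e * m` lies in `H_e`. -/
theorem exists_toSchutzenberger_eq {e g g' : M} (hg' : g * g' * g = g) (he : g' * g = e)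
    (a : SchutzenbergerGroup g) : ∃ x ∈ HClass e, toSchutzenberger g x = a := by
  have hge : g * e = g := by rw [← he, ← mul_assoc, hg']
  have hee : e * e = e := by nth_rewrite 1 [← he]; rw [mul_assoc, hge, he]
  have hL : GreenL e g := greenL_iff.2 ⟨⟨g', he.symm⟩, g, hge.symm⟩
  obtain ⟨m, hm, ha⟩ := a.2
  have hgm : GreenH g (g * m) := hm g (self_mem_hClass g)
  have hx : e * m ∈ HClass e := by
    refine ⟨?_, ?_⟩
    · exact (hL.trans hgm.1 : GreenL e (g * m)).trans (GreenL.mul_right hL.symm m)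
    · have h := GreenR.mul_left hgm.2 g'
      rwa [← mul_assoc, he] at h
  refine ⟨e * m, hx, ?_⟩
  refine Subtype.ext (MulOpposite.unop_injective (Equiv.ext fun h => Subtype.ext ?_))
  rw [toSchutzenberger_apply (hClass_subset_rightTranslators hee hL hx), ha]
  obtain ⟨-, u, hu⟩ := greenL_iff.1 (hL.trans h.2.1 : GreenL e h)
  rw [hu, ← mul_assoc, mul_assoc u, hee]

end Monoid

/-! ## Strongly compatible twistings -/

section Twisting

variable {k : Type*} [Field k] {M : Type*} [Monoid M] {π : Twisting M k}

theorem GreenL.greenD {x y : M} (h : GreenL x y) : GreenD x y := ⟨y, h, rfl⟩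

theorem GreenR.greenD {x y : M} (h : GreenR x y) : GreenD x y := ⟨x, rfl, h⟩

theorem Twisting.StronglyCompatible.ne_zero_of_left (hπ : π.StronglyCompatible) {a x w : M}
    (h : x = w * (a * x)) : π a x ≠ 0 :=
  (hπ.1 a x (greenL_iff.2 ⟨⟨a, rfl⟩, w, h⟩ : GreenL _ _).greenD x (self_mem_hClass x)).2

theorem Twisting.StronglyCompatible.ne_zero_of_right (hπ : π.StronglyCompatible) {a x w : M}
    (h : x = x * a * w) : π x a ≠ 0 :=
  (hπ.2 a x (greenR_iff.2 ⟨⟨a, rfl⟩, w, h⟩ : GreenR _ _).greenD x (self_mem_hClass x)).2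

theorem Twisting.StronglyCompatible.self_ne_zero (hπ : π.StronglyCompatible) {e : M}
    (he : e * e = e) : π e e ≠ 0 :=
  hπ.ne_zero_of_left (w := e) (by rw [he, he])

theorem Twisting.StronglyCompatible.apply_idempotent_left (hπ : π.StronglyCompatible) {e x : M}
    (he : e * e = e) (hx : e * x = x) : π e x = π e e := by
  have h := π.cocycle e e x
  rw [he, hx] at h
  exact (mul_right_cancel₀ (hπ.ne_zero_of_left (w := e) (by rw [hx, hx])) h).symm

theorem Twisting.StronglyCompatible.apply_idempotent_right (hπ : π.StronglyCompatible) {e x : M}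
    (he : e * e = e) (hx : x * e = x) : π x e = π e e := by
  have h := π.cocycle x e e
  rw [he, hx] at h
  exact mul_left_cancel₀ (hπ.ne_zero_of_right (w := e) (by rw [hx, hx])) h

/-- A strongly compatible twisting is constant on a maximal subgroup. -/
theorem Twisting.StronglyCompatible.apply_hClass (hπ : π.StronglyCompatible) {e x y : M}
    (he : e * e = e) (hx : x ∈ HClass e) (hy : y ∈ HClass e) : π x y = π e e := by
  have hxe := ((mem_hClass_idempotent_iff he).1 hx).1.2
  rw [← hπ.apply_idempotent_right he hxe]
  refine (hπ.1 x e ?_ y hy).1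
  rw [hxe]
  exact (GreenL.greenD hx.1.symm)

end Twisting

/-! ## The corner of the twisted monoid algebra at an idempotent -/

namespace TwistedMonoidAlgebra

variable {k : Type*} [Field k] {M : Type*} [Monoid M] (π : Twisting M k)

instance instFinite [Finite M] : Module.Finite k (TwistedMonoidAlgebra π) :=
  Module.Finite.of_basis (basis π)

/-- The span of the local submonoid `e M e`. -/
noncomputable def corner (e : M) : Submodule k (TwistedMonoidAlgebra π) :=
  Submodule.span k (basis π '' {x | e * x = x ∧ x * e = x})

variable {π}

theorem basis_mem_corner {e x : M} (hx : e * x = x ∧ x * e = x) : basis π x ∈ corner π e :=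
  Submodule.subset_span ⟨x, hx, rfl⟩

theorem basis_mul_mul_basis_mem_corner {e a b : M} (ha : e * a = a) (hb : b * e = b)
    (s : TwistedMonoidAlgebra π) : basis π a * s * basis π b ∈ corner π e := by
  induction (basis π).mem_span s using Submodule.span_induction with
  | zero => simp
  | add x y _ _ hx hy => rw [mul_add, add_mul]; exact add_mem hx hy
  | smul r x _ hx => rw [mul_smul_comm, smul_mul_assoc]; exact Submodule.smul_mem _ r hx
  | mem y hy =>
    obtain ⟨y, rfl⟩ := hy
    rw [basis_mul_basis, smul_mul_assoc, basis_mul_basis]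
    refine Submodule.smul_mem _ _ (Submodule.smul_mem _ _ (basis_mem_corner ⟨?_, ?_⟩))
    · simp only [← mul_assoc, ha]
    · rw [mul_assoc, hb]

theorem mul_mem_corner {e : M} {s t : TwistedMonoidAlgebra π}
    (hs : s ∈ corner π e) (ht : t ∈ corner π e) : s * t ∈ corner π e := by
  induction hs, ht using Submodule.span_induction₂ with
  | zero_left y hy => simp
  | zero_right y hy => simp
  | add_left x y z _ _ _ h1 h2 => rw [add_mul]; exact add_mem h1 h2
  | add_right x y z _ _ _ h1 h2 => rw [mul_add]; exact add_mem h1 h2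
  | smul_left r x y _ _ h => rw [smul_mul_assoc]; exact Submodule.smul_mem _ r h
  | smul_right r x y _ _ h => rw [mul_smul_comm]; exact Submodule.smul_mem _ r h
  | mem_mem x y hx hy =>
    obtain ⟨x, hx, rfl⟩ := hx
    obtain ⟨y, hy, rfl⟩ := hy
    rw [basis_mul_basis]
    exact Submodule.smul_mem _ _ (basis_mem_corner
      ⟨by rw [← mul_assoc, hx.1], by rw [mul_assoc, hy.2]⟩)

theorem basis_mul_of_mem_corner (hπ : π.StronglyCompatible) {e : M} (he : e * e = e)
    {s : TwistedMonoidAlgebra π} (hs : s ∈ corner π e) : basis π e * s = π e e • s := by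
  induction hs using Submodule.span_induction with
  | zero => simp
  | add x y _ _ hx hy => rw [mul_add, hx, hy, smul_add]
  | smul r x _ hx => rw [mul_smul_comm, hx, smul_comm]
  | mem x hx =>
    obtain ⟨x, hx, rfl⟩ := hx
    rw [basis_mul_basis, hx.1, hπ.apply_idempotent_left he hx.1]

theorem mul_basis_of_mem_corner (hπ : π.StronglyCompatible) {e : M} (he : e * e = e)
    {s : TwistedMonoidAlgebra π} (hs : s ∈ corner π e) : s * basis π e = π e e • s := by
  induction hs using Submodule.span_induction with
  | zero => simp
  | add x y _ _ hx hy => rw [add_mul, hx, hy, smul_add]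
  | smul r x _ hx => rw [smul_mul_assoc, hx, smul_comm]
  | mem x hx =>
    obtain ⟨x, hx, rfl⟩ := hx
    rw [basis_mul_basis, hx.2, hπ.apply_idempotent_right he hx.2]

variable (π)

open Classical in
/-- The linear map to the group algebra of the Schützenberger group of `g` that sends `x` in the
`H`-class of the idempotent `e` to the scaled right translation `π(e, e) r_x`, and all other
elements of the monoid to zero. -/
noncomputable def toGroupAlgebra (e g : M) :
    TwistedMonoidAlgebra π →ₗ[k] MonoidAlgebra k (SchutzenbergerGroup g) :=
  (basis π).constr k fun x =>
    if x ∈ HClass e then MonoidAlgebra.single (toSchutzenberger g x) (π e e) else 0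

variable {π}

theorem toGroupAlgebra_basis {e g x : M} (hx : x ∈ HClass e) :
    toGroupAlgebra π e g (basis π x) =
      MonoidAlgebra.single (toSchutzenberger g x) (π e e) := by
  rw [toGroupAlgebra, Module.Basis.constr_basis, if_pos hx]

theorem toGroupAlgebra_basis_of_notMem {e g x : M} (hx : x ∉ HClass e) :
    toGroupAlgebra π e g (basis π x) = 0 := by
  rw [toGroupAlgebra, Module.Basis.constr_basis, if_neg hx]

theorem toGroupAlgebra_mul [Finite M] (hπ : π.StronglyCompatible) {e g : M} (he : e * e = e)
    (hg : GreenL e g) {s t : TwistedMonoidAlgebra π} (hs : s ∈ corner π e)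
    (ht : t ∈ corner π e) :
    toGroupAlgebra π e g (s * t) = toGroupAlgebra π e g s * toGroupAlgebra π e g t := by
  induction hs, ht using Submodule.span_induction₂ with
  | zero_left y hy => simp
  | zero_right y hy => simp
  | add_left x y z _ _ _ h1 h2 => rw [add_mul, map_add, map_add, add_mul, h1, h2]
  | add_right x y z _ _ _ h1 h2 => rw [mul_add, map_add, map_add, mul_add, h1, h2]
  | smul_left r x y _ _ h => rw [smul_mul_assoc, map_smul, map_smul, smul_mul_assoc, h]
  | smul_right r x y _ _ h => rw [mul_smul_comm, map_smul, map_smul, mul_smul_comm, h]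
  | mem_mem x y hx hy =>
    obtain ⟨x, hx, rfl⟩ := hx
    obtain ⟨y, hy, rfl⟩ := hy
    rw [basis_mul_basis, map_smul]
    by_cases hxy : x ∈ HClass e ∧ y ∈ HClass e
    · obtain ⟨hx', hy'⟩ := hxy
      -- Both sides carry the factor `π(e, e)²`: on the left one factor is the twisting, on the
      -- right each image contributes one.
      rw [toGroupAlgebra_basis hx', toGroupAlgebra_basis hy',
        toGroupAlgebra_basis (mul_mem_hClass_idempotent he hx' hy'),
        MonoidAlgebra.single_mul_single, MonoidAlgebra.smul_single,
        toSchutzenberger_mul (hClass_subset_rightTranslators he hg hx')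
          (hClass_subset_rightTranslators he hg hy'), hπ.apply_hClass he hx' hy', smul_eq_mul]
    · rw [toGroupAlgebra_basis_of_notMem fun h => hxy (mem_hClass_of_mul_mem he hx hy h),
        smul_zero]
      by_cases hx' : x ∈ HClass e
      · rw [toGroupAlgebra_basis_of_notMem fun h => hxy ⟨hx', h⟩, mul_zero]
      · rw [toGroupAlgebra_basis_of_notMem hx', zero_mul]

theorem exists_toGroupAlgebra_eq (hπ : π.StronglyCompatible) {e g g' : M}
    (hg' : g * g' * g = g) (he : g' * g = e) (w : MonoidAlgebra k (SchutzenbergerGroup g)) :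
    ∃ s ∈ corner π e, toGroupAlgebra π e g s = w := by
  have hee : e * e = e := by rw [← he, mul_assoc, ← mul_assoc g, hg']
  induction w using MonoidAlgebra.induction_linear with
  | zero => exact ⟨0, zero_mem _, map_zero _⟩
  | add v w hv hw =>
    obtain ⟨s, hs, rfl⟩ := hv
    obtain ⟨t, ht, rfl⟩ := hw
    exact ⟨s + t, add_mem hs ht, map_add _ _ _⟩
  | single a r =>
    obtain ⟨x, hx, rfl⟩ := exists_toSchutzenberger_eq hg' he a
    refine ⟨(r * (π e e)⁻¹) • basis π x, Submodule.smul_mem _ _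
      (basis_mem_corner ((mem_hClass_idempotent_iff hee).1 hx).1), ?_⟩
    rw [map_smul, toGroupAlgebra_basis hx, MonoidAlgebra.smul_single, smul_eq_mul, mul_assoc,
      inv_mul_cancel₀ (hπ.self_ne_zero hee), mul_one]

theorem coeff_one_toGroupAlgebra_basis {e g x : M} (he : e * e = e) (hg : GreenL e g)
    [Decidable (x = e)] :
    (toGroupAlgebra π e g (basis π x)).coeff 1 = if x = e then π e e else 0 := by
  classical
  by_cases hx : x ∈ HClass e
  · rw [toGroupAlgebra_basis hx, MonoidAlgebra.coeff_single, Finsupp.single_apply]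
    simp only [toSchutzenberger_eq_one_iff he hg hx]
  · rw [toGroupAlgebra_basis_of_notMem hx, if_neg]
    · rfl
    · rintro rfl
      exact hx (self_mem_hClass x)

/-- A generalized inverse of a corner element can be compressed into the corner and then pushed to
the quotient `k[G_D]`. -/
theorem isVonNeumannRegular_groupAlgebra [Finite M] (hM : IsInverseMonoid M)
    (hπ : π.StronglyCompatible) (hA : IsVonNeumannRegular (TwistedMonoidAlgebra π)) (g : M) :
    IsVonNeumannRegular (MonoidAlgebra k (SchutzenbergerGroup g)) := by
  obtain ⟨g', ⟨hg', -⟩, -⟩ := hM g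
  obtain ⟨e, he⟩ : ∃ e, g' * g = e := ⟨_, rfl⟩
  have hee : e * e = e := by rw [← he, mul_assoc, ← mul_assoc g, hg']
  have hL : GreenL e g := greenL_iff.2 ⟨⟨g', he.symm⟩, g, by rw [← he, ← mul_assoc, hg']⟩
  have hc := hπ.self_ne_zero hee
  intro z
  obtain ⟨s, hs, rfl⟩ := exists_toGroupAlgebra_eq hπ hg' he z
  obtain ⟨t, ht⟩ := hA s
  have h1 : s = (π e e)⁻¹ • (basis π e * s) := by
    rw [basis_mul_of_mem_corner hπ hee hs, smul_smul, inv_mul_cancel₀ hc, one_smul]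
  have h2 : s = (π e e)⁻¹ • (s * basis π e) := by
    rw [mul_basis_of_mem_corner hπ hee hs, smul_smul, inv_mul_cancel₀ hc, one_smul]
  have h3 : (basis π e * t * basis π e) ∈ corner π e :=
    basis_mul_mul_basis_mem_corner hee hee t
  -- As `e / π(e, e)` is the identity of the corner, compressing `t` on both sides costs two factors
  -- `π(e, e)⁻¹`.
  obtain ⟨t', ht'⟩ : ∃ t', t' = (π e e)⁻¹ • (π e e)⁻¹ • (basis π e * t * basis π e) := ⟨_, rfl⟩
  have h4 : t' ∈ corner π e := by
    rw [ht']; exact Submodule.smul_mem _ _ (Submodule.smul_mem _ _ h3)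
  have h5 : s * t' * s = s := by
    calc s * t' * s = ((π e e)⁻¹ • (s * basis π e)) * t * ((π e e)⁻¹ • (basis π e * s)) := by
          rw [ht']
          simp only [mul_smul_comm, smul_mul_assoc, mul_assoc]
      _ = s := by rw [← h1, ← h2, ht]
  refine ⟨toGroupAlgebra π e g t', ?_⟩
  rw [← toGroupAlgebra_mul hπ hee hL hs h4,
    ← toGroupAlgebra_mul hπ hee hL (mul_mem_corner hs h4) hs, h5]

/-! ### Detecting radical elements in the group algebras. -/

/-- If `m` generates a maximal two-sided ideal among the elements of the support of `x`, then a
suitable two-sided multiple of `x` is detected by the group algebra attached to the `D`-class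
of `m`. -/
theorem coeff_one_toGroupAlgebra_ne_zero [Finite M] (hM : IsInverseMonoid M)
    (hπ : π.StronglyCompatible) {x : TwistedMonoidAlgebra π} {m e g a b a' b' : M}
    (he : e * e = e) (hL : GreenL e g) (hab : a * m * b = e) (hm : m = a' * e * b')
    (hmx : (basis π).repr x m ≠ 0)
    (hmax : ∀ y, (basis π).repr x y ≠ 0 → (∃ u v, m = u * y * v) → ∃ u v, y = u * m * v) :
    (toGroupAlgebra π e g (basis π a * x * basis π b)).coeff 1 ≠ 0 := by
  classical
  have hm' : m = a' * (a * m * b) * b' := by rw [hab, ← hm]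
  -- If `a * y * b = e`, then `m ∈ MyM`; maximality gives `y ∈ MmM`, and cancellation forces `y =
  -- m`.
  have hy : ∀ y, (basis π).repr x y ≠ 0 → y ≠ m → a * y * b ≠ e := by
    intro y hyx hne h
    obtain ⟨u, v, huv⟩ := hmax y hyx ⟨a' * a, b * b', by
      rw [hm, ← h]; simp only [mul_assoc]⟩
    refine hne (hM.eq_of_mul_mul_eq (a := a) (b := b) ⟨u * a', b' * v, ?_⟩ ⟨a', b', hm'⟩
      (h.trans hab.symm))
    rw [h, huv]
    nth_rewrite 1 [hm]
    simp only [mul_assoc]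
  let F : TwistedMonoidAlgebra π →ₗ[k] k :=
    Finsupp.lapply 1 ∘ₗ (MonoidAlgebra.coeffLinearEquiv k).toLinearMap ∘ₗ
      toGroupAlgebra π e g ∘ₗ LinearMap.mulRight k (basis π b) ∘ₗ
      LinearMap.mulLeft k (basis π a)
  have hF : ∀ y, F (basis π y) = π a y * (π (a * y) b * if a * y * b = e then π e e else 0) := by
    intro y
    change (toGroupAlgebra π e g (basis π a * basis π y * basis π b)).coeff 1 = _
    rw [basis_mul_basis, smul_mul_assoc, basis_mul_basis, map_smul, map_smul,
      MonoidAlgebra.coeff_smul_apply, MonoidAlgebra.coeff_smul_apply,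
      coeff_one_toGroupAlgebra_basis he hL, smul_eq_mul, smul_eq_mul]
  have hFx : F x = (basis π).repr x m * F (basis π m) := by
    nth_rewrite 1 [← (basis π).linearCombination_repr x]
    rw [Finsupp.linearCombination_apply, Finsupp.sum, map_sum, Finset.sum_eq_single m]
    · rw [map_smul, smul_eq_mul]
    · intro y hyx hne
      rw [map_smul, hF, if_neg (hy y (Finsupp.mem_support_iff.1 hyx) hne), mul_zero, mul_zero,
        smul_zero]
    · intro h
      exact absurd (Finsupp.mem_support_iff.2 hmx) h
  change F x ≠ 0
  -- By stability `m` is `L`-related to `a * m`, and `a * m` is `R`-related to `a * m * b`; hence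
  -- both twisting factors are nonzero.
  have hm2 : m = a' * a * m * (b * b') := by
    nth_rewrite 1 [hm']; simp only [mul_assoc]
  obtain ⟨⟨w, hw⟩, w', hw'⟩ := exists_eq_of_eq_mul_mul hm2
  rw [hFx, hF, if_pos hab]
  refine mul_ne_zero hmx (mul_ne_zero ?_ (mul_ne_zero ?_ (hπ.self_ne_zero he)))
  · exact hπ.ne_zero_of_left (w := w * a') (hw.trans (by simp only [mul_assoc]))
  · refine hπ.ne_zero_of_right (w := b' * w') ?_
    nth_rewrite 1 [hw']
    simp only [mul_assoc]

theorem isSemisimpleRing_of_groupAlgebra [Finite M] (hM : IsInverseMonoid M)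
    (hπ : π.StronglyCompatible) (γ : DClass M → M) (hγ : ∀ D : DClass M, DClass.mk (γ D) = D)
    (hG : ∀ D : DClass M, IsVonNeumannRegular (MonoidAlgebra k (SchutzenbergerGroup (γ D)))) :
    IsSemisimpleRing (TwistedMonoidAlgebra π) := by
  have : IsArtinianRing (TwistedMonoidAlgebra π) := IsArtinianRing.of_finite k _
  rw [IsArtinianRing.isSemisimpleRing_iff_jacobson, eq_bot_iff]
  intro x hx
  by_contra hx0
  have hne : ((basis π).repr x).support.Nonempty := by
    rw [Finsupp.support_nonempty_iff]
    intro h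
    exact hx0 ((basis π).repr.map_eq_zero_iff.1 h)
  -- Support elements are compared by inclusion of their two-sided ideals.
  obtain ⟨m, hm, hmax⟩ := Finset.exists_maximalFor (fun y : M => {z | ∃ u v, z = u * y * v}) _ hne
  obtain ⟨z, hz1, hz2⟩ : GreenD m (γ (DClass.mk m)) := Quotient.exact (hγ (DClass.mk m)).symm
  generalize DClass.mk m = D at hz2
  obtain ⟨⟨s', hs'⟩, s, hs⟩ := greenL_iff.1 hz1
  obtain ⟨⟨r, hr⟩, r', hr'⟩ := greenR_iff.1 hz2
  obtain ⟨g', ⟨hg', -⟩, -⟩ := hM (γ D)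
  obtain ⟨e, he⟩ : ∃ e, g' * γ D = e := ⟨_, rfl⟩
  have hge : γ D * e = γ D := by rw [← he, ← mul_assoc, hg']
  have hee : e * e = e := by nth_rewrite 1 [← he]; rw [mul_assoc, hge, he]
  have hL : GreenL e (γ D) := greenL_iff.2 ⟨⟨g', he.symm⟩, γ D, hge.symm⟩
  -- Here `s` moves `m` to `z` and `r'` moves `z` to `γ D`, so `g' * (s * m * r') = e`; the outer
  -- factors `e` place the product in the corner.
  have hab : e * g' * s * m * (r' * e) = e := by
    calc e * g' * s * m * (r' * e) = e * (g' * (s * m * r')) * e := by simp only [mul_assoc]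
      _ = e := by rw [← hs, ← hr', he, hee, hee]
  have hme : m = s' * γ D * e * r := by
    rw [mul_assoc s', hge, mul_assoc, ← hr, ← hs']
  have hcoeff := coeff_one_toGroupAlgebra_ne_zero (π := π) hM hπ hee hL hab hme
    (Finsupp.mem_support_iff.1 hm) (fun y hy ⟨u, v, huv⟩ => by
      refine hmax (Finsupp.mem_support_iff.2 hy) ?_ ⟨1, 1, by simp⟩
      rintro _ ⟨p, q, rfl⟩
      exact ⟨p * u, v * q, by rw [huv]; simp only [mul_assoc]⟩)
  have hcorner : basis π (e * g' * s) * x * basis π (r' * e) ∈ corner π e :=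
    basis_mul_mul_basis_mem_corner (by simp only [← mul_assoc, hee]) (by rw [mul_assoc, hee]) x
  have hrad : basis π (e * g' * s) * x * basis π (r' * e) ∈
      Ring.jacobson (TwistedMonoidAlgebra π) :=
    Ideal.mul_mem_right _ _ (Ideal.mul_mem_left _ _ hx)
  generalize basis π (e * g' * s) * x * basis π (r' * e) = y at hcoeff hcorner hrad
  refine hcoeff ?_
  rw [(hG D).eq_zero (z := toGroupAlgebra π e (γ D) y) ?_]
  · rfl
  intro w
  obtain ⟨t, ht, rfl⟩ := exists_toGroupAlgebra_eq hπ hg' he w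
  obtain ⟨n, hn⟩ := isNilpotent_of_mem_jacobson (Ideal.mul_mem_left _ t hrad)
  have hty := mul_mem_corner ht hcorner
  -- Only positive powers are used, since the identity of the whole algebra need not lie in the
  -- corner.
  have hpow : ∀ i : ℕ, (t * y) ^ (i + 1) ∈ corner π e ∧
      toGroupAlgebra π e (γ D) ((t * y) ^ (i + 1)) =
        toGroupAlgebra π e (γ D) (t * y) ^ (i + 1) := by
    intro i
    induction i with
    | zero => simpa using hty
    | succ i ih =>
      rw [pow_succ _ (i + 1), pow_succ _ (i + 1), toGroupAlgebra_mul hπ hee hL ih.1 hty, ih.2]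
      exact ⟨mul_mem_corner ih.1 hty, rfl⟩
  refine ⟨n + 1, ?_⟩
  rw [← toGroupAlgebra_mul hπ hee hL ht hcorner, ← (hpow n).2, pow_succ, hn, zero_mul, map_zero]

end TwistedMonoidAlgebra

theorem proposition5p7 {k : Type*} [Field k] {M : Type*} [Monoid M] [Finite M]
    (hM : IsInverseMonoid M)
    (γ : DClass M → M) (hγ : ∀ D : DClass M, DClass.mk (γ D) = D)
    (hCA : SatisfiesCA k γ)
    (π : Twisting M k) (hπ : π.StronglyCompatible) :
    IsSemisimpleRing (TwistedMonoidAlgebra π) ↔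
      ∀ D : DClass M, IsSemisimpleRing (MonoidAlgebra k (SchutzenbergerGroup (γ D))) := by
  -- Found by instance resolution below, where regularity of the group algebra is turned back into
  -- semisimplicity.
  have hfin : ∀ D, IsArtinianRing (MonoidAlgebra k (SchutzenbergerGroup (γ D))) := fun D =>
    have : Finite (Equiv.Perm (HClass (γ D)))ᵐᵒᵖ := Finite.of_equiv _ MulOpposite.opEquiv
    have : Module.Finite k (MonoidAlgebra k (SchutzenbergerGroup (γ D))) :=
      Module.Finite.equiv (MonoidAlgebra.coeffLinearEquiv k).symm
    IsArtinianRing.of_finite k _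
  refine ⟨fun h D => ?_, fun h => ?_⟩
  · exact (TwistedMonoidAlgebra.isVonNeumannRegular_groupAlgebra hM hπ
      (IsSemisimpleRing.isVonNeumannRegular _) (γ D)).isSemisimpleRing
  · exact TwistedMonoidAlgebra.isSemisimpleRing_of_groupAlgebra hM hπ γ hγ fun D =>
      IsSemisimpleRing.isVonNeumannRegular _
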